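/- **Setting.** Let $M=(E,f)$ be a polymatroid on $E=\{1,\dots,L\}$: $f:2^E\to[0,\infty)$ is monotone, submodular, and $f(\emptyset)=0$. Assume $f(\{e\})\le 1$ for all $e\in E$, and let $K=f(E)$. For ${\bf w}\in\mathbb{R}^L$, ${\tt Greedy}(M,{\bf w})$ is the vector ${\bf x}$ with ${\bf x}(e_i)=f(\{e_1,\dots,e_i\})-f(\{e_1,\dots,e_{i-1}\})$, where $e_1,\dots,e_L$ is an ordering of the items with ${\bf w}(e_1)\ge\dots\ge{\bf w}(e_L)$, and ties are broken by an arbitrary but fixed (measurable) rule. Let $\Theta=\{{\tt Greedy}(M,{\bf w}):{\bf w}\in[0,\infty)^L\}$. Let $P$ be a probability distribution on $[0,1]^L$ with mean $\bar{\bf w}$, let ${\bf w}_0,{\bf w}_1,{\bf w}_2,\dots$ be i.i.d. from $P$, and let ${\bf x}^\ast\in\Theta$ maximize $\langle\bar{\bf w},{\bf x}\rangle$ over ${\bf x}\in\Theta$. **Algorithm.** ${\tt OPM}$ starts from $T_0(e)=1$ and $\hat{\bf w}(e)={\bf w}_0(e)$ for all $e\in E$. In episode $t=1,2,\dots$ it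 computes $$U_t(e)=\hat{\bf w}(e)+c_{t-1,T_{t-1}(e)},\qquad c_{t,s}=\sqrt{\frac{2\log t}{s}}\quad(t\ge1),\qquad c_{0,s}=0,$$ and chooses ${\bf x}_t={\tt Greedy}(M,U_t)$. For each $e$ with ${\bf x}_t(e)>0$ it observes ${\bf w}_t(e)$, sets $T_t(e)=T_{t-1}(e)+1$, and replaces $\hat{\bf w}(e)$ by $\bigl(T_{t-1}(e)\,\hat{\bf w}(e)+{\bf w}_t(e)\bigr)/T_t(e)$. For all other $e$, $T_t(e)=T_{t-1}(e)$ and $\hat{\bf w}(e)$ is unchanged. **Theorem (gap-free bound).** For every $n\ge1$, the expected cumulative regret $$R(n)=\mathbb{E}\Bigl[\sum_{t=1}^n\bigl(\langle{\bf w}_t,{\bf x}^\ast\rangle-\langle{\bf w}_t,{\bf x}_t\rangle\bigr)\Bigr]$$ of ${\tt OPM}$ (the expectation is over ${\bf w}_0,\dots,{\bf w}_n$, and the sum is integrable) satisfies $$R(n)\le 8\sqrt{K L\,n\log n}+\frac{4}{3}\pi^2L^2 .$$ -/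

import Mathlib

namespace PolymatroidBandit

open MeasureTheory

/-- A polymatroid `(E, f)` on the ground set `E = Fin L`: the function `f` is monotone,
submodular and vanishes on the empty set. (Hence `f` is nonnegative.) -/
structure Polymatroid (L : ℕ) where
  f : Finset (Fin L) → ℝ
  empty : f ∅ = 0
  mono : ∀ X Y : Finset (Fin L), X ⊆ Y → f X ≤ f Y
  submodular : ∀ X Y : Finset (Fin L), f (X ∪ Y) + f (X ∩ Y) ≤ f X + f Y

/-- The rank `K = f(E)`. -/
def Polymatroid.rank {L : ℕ} (M : Polymatroid L) : ℝ := M.f Finset.univ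

/-- A fixed rule that sorts the items by decreasing weight; how it breaks ties is arbitrary
(up to measurability). The `i`-th item in the order is `order w i`. -/
structure SortRule (L : ℕ) where
  order : (Fin L → ℝ) → Equiv.Perm (Fin L)
  sorted : ∀ w : Fin L → ℝ, Antitone (fun i => w (order w i))
  measurable : ∀ σ : Equiv.Perm (Fin L), MeasurableSet {w : Fin L → ℝ | order w = σ}

/-- Such a rule exists: break ties in favour of the smaller index. -/
instance SortRule.instNonempty (L : ℕ) : Nonempty (SortRule L) := by
  refine ⟨⟨fun w => Tuple.sort (fun i => -w i), fun w i j hij => ?_, fun σ => ?_⟩⟩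
  · have h := Tuple.monotone_sort (fun i => -w i) hij
    simpa using h
  · have h : {w : Fin L → ℝ | Tuple.sort (fun i => -w i) = σ} =
        {w | ∀ i j, (i ≤ j → w (σ j) ≤ w (σ i)) ∧
          (i < j → w (σ i) = w (σ j) → σ i < σ j)} := by
      ext w
      simp only [Set.mem_ofPred_eq]
      rw [eq_comm, Tuple.eq_sort_iff]
      simp only [Monotone, Function.comp, neg_le_neg_iff, neg_inj]
      constructor
      · rintro ⟨h1, h2⟩ i j
        exact ⟨fun h => h1 h, fun h => h2 i j h⟩
      · intro h
        exact ⟨fun i j hij => (h i j).1 hij, fun i j hij => (h i j).2 hij⟩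
    rw [h]
    measurability

/-- The basis `x = Greedy(M, w)`: if `e = e_i` is the `i`-th item in the order of decreasing
weights, then `x(e) = f({e_1, …, e_i}) - f({e_1, …, e_{i-1}})`. -/
noncomputable def greedy {L : ℕ} (M : Polymatroid L) (r : SortRule L) (w : Fin L → ℝ) :
    Fin L → ℝ := fun e =>
  M.f ((Finset.Iic ((r.order w).symm e)).image (r.order w)) -
    M.f ((Finset.Iio ((r.order w).symm e)).image (r.order w))

/-- The feasible solutions `Θ`: bases computed greedily for some nonnegative weight vector. -/
def feasible {L : ℕ} (M : Polymatroid L) (r : SortRule L) : Set (Fin L → ℝ) :=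
  {x | ∃ w : Fin L → ℝ, 0 ≤ w ∧ x = greedy M r w}

/-- The expected weights `w̄(e) = E[w(e)]` under the weight distribution `P`. -/
noncomputable def meanWeight {L : ℕ} (P : Measure (Fin L → ℝ)) : Fin L → ℝ :=
  fun e => ∫ w, w e ∂P

/-- `x` is an optimal solution: a feasible maximizer of the expected return `⟨w̄, x⟩` over `Θ`. -/
def IsOptimal {L : ℕ} (M : Polymatroid L) (r : SortRule L) (P : Measure (Fin L → ℝ))
    (x : Fin L → ℝ) : Prop :=
  x ∈ feasible M r ∧ ∀ y ∈ feasible M r, meanWeight P ⬝ᵥ y ≤ meanWeight P ⬝ᵥ x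

/-- The confidence radius `c_{t,s} = √(2 log t / s)`, where `c_{0,s} = 0` (as `Real.log 0 = 0`). -/
noncomputable def radius (t s : ℕ) : ℝ := Real.sqrt (2 * Real.log t / s)

/-- The statistics kept by the algorithm: the number of observations `T(e)` of each item and
the average `est e` of the observed weights of item `e`. -/
structure OPMState (L : ℕ) where
  T : Fin L → ℕ
  est : Fin L → ℝ

/-- The upper confidence bounds `U_{t+1}(e)`, computed from the statistics `s` after
episode `t`. -/
noncomputable def ucb {L : ℕ} (t : ℕ) (s : OPMState L) : Fin L → ℝ :=
  fun e => s.est e + radius t (s.T e)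

/-- The update of the statistics `s` after choosing the basis `x`, when the weights of this
episode are `v`; only the entries `v e` with `0 < x e` are used. -/
noncomputable def update {L : ℕ} (s : OPMState L) (x v : Fin L → ℝ) : OPMState L where
  T := fun e => if 0 < x e then s.T e + 1 else s.T e
  est := fun e =>
    if 0 < x e then ((s.T e : ℝ) * s.est e + v e) / ((s.T e : ℝ) + 1) else s.est e

/-- The statistics of OPM after episode `t`, when the weights are `w 0` (initialization) and
`w 1, w 2, …` (episodes `1, 2, …`). -/
noncomputable def opmState {L : ℕ} (M : Polymatroid L) (r : SortRule L)
    (w : ℕ → Fin L → ℝ) : ℕ → OPMState L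
  | 0 => { T := fun _ => 1, est := w 0 }
  | t + 1 => update (opmState M r w t) (greedy M r (ucb t (opmState M r w t))) (w (t + 1))

/-- The basis `x_{t+1}` that OPM chooses in episode `t + 1`, for `t = 0, 1, 2, …`. -/
noncomputable def opmBasis {L : ℕ} (M : Polymatroid L) (r : SortRule L)
    (w : ℕ → Fin L → ℝ) (t : ℕ) : Fin L → ℝ :=
  greedy M r (ucb t (opmState M r w t))

/-- The regret `∑_{t=1}^n (⟨w_t, x*⟩ - ⟨w_t, x_t⟩)` of OPM in the first `n` episodes, for the
realized weights `w 0, w 1, …`, relative to the basis `xstar`. -/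
noncomputable def regret {L : ℕ} (M : Polymatroid L) (r : SortRule L) (xstar : Fin L → ℝ)
    (w : ℕ → Fin L → ℝ) (n : ℕ) : ℝ :=
  ∑ t ∈ Finset.range n, (w (t + 1) ⬝ᵥ xstar - w (t + 1) ⬝ᵥ opmBasis M r w t)

end PolymatroidBandit

open PolymatroidBandit MeasureTheory ProbabilityTheory

/-!
The regret bound rests on optimism. Greedy bases lie in the base polytope
(`sum_greedy_le`, `sum_greedy`) and the greedy basis for `U` maximizes `⟨U, ·⟩` over them
(`dotProduct_greedy_le`). So in an episode in which all estimates are within their confidence radii,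
the expected loss of the chosen basis `x` is at most `2 ∑ₑ x(e) c(e)`, where `c(e)` is the current
radius (`gap_le`).

Along every run these terms add up to `O(√(K L n log n))` (`sum_radius_le`). A naive Cauchy–Schwarz
estimate would lose another factor `√log n`; it is avoided by noting that the mass `∑ x(e)` which
item `e` has received never exceeds its number of observations `T(e)`, so that `√(∑ x(e))` is a
potential for `∑ x(e) / √T(e)` (`sum_div_sqrt_le`). Since `∑ₑ x(e) = K`, Cauchy–Schwarz over the
items gives the bound.

The remaining episodes cost at most `K ≤ L` each, and some estimate fails after episode `t` with
probability `O(L / t²)` (`measure_estimateFails_le`). The number of observations of an item depends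
on the earlier weights, so the estimates are not averages of a fixed number of independent
variables. Instead, `expDeviation`, the exponential of `a T (ŵ - w̄) - T a² / 8`, is a
supermartingale by Hoeffding's lemma and the independence of each episode from the past
(`lintegral_expDeviation_le_one`), and Markov's inequality is applied to it on each event `T = s`,
with `a` tuned to `s`.
-/

namespace PolymatroidBandit

/-! ### Greedy bases -/

section Greedy

variable {L : ℕ}

/-- The first `k` items in the order `σ`. -/
def itemPrefix (σ : Equiv.Perm (Fin L)) (k : ℕ) : Finset (Fin L) :=
  Finset.univ.filter fun e => (σ.symm e : ℕ) < k

@[simp] lemma mem_itemPrefix {σ : Equiv.Perm (Fin L)} {k : ℕ} {e : Fin L} :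
    e ∈ itemPrefix σ k ↔ (σ.symm e : ℕ) < k := by
  simp [itemPrefix]

lemma itemPrefix_zero (σ : Equiv.Perm (Fin L)) : itemPrefix σ 0 = ∅ := by
  ext e; simp

lemma itemPrefix_card (σ : Equiv.Perm (Fin L)) : itemPrefix σ L = Finset.univ := by
  ext e; simp

lemma itemPrefix_mono (σ : Equiv.Perm (Fin L)) : Monotone (itemPrefix σ) := by
  intro k l h e he
  rw [mem_itemPrefix] at *
  omega

lemma itemPrefix_succ (σ : Equiv.Perm (Fin L)) (e : Fin L) :
    itemPrefix σ (σ.symm e + 1) = insert e (itemPrefix σ (σ.symm e)) := by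
  ext a
  simp only [mem_itemPrefix, Finset.mem_insert, Nat.lt_succ_iff_lt_or_eq, ← Fin.ext_iff,
    EmbeddingLike.apply_eq_iff_eq]
  exact or_comm

lemma greedy_eq (M : Polymatroid L) (r : SortRule L) (w : Fin L → ℝ) (e : Fin L) :
    greedy M r w e = M.f (itemPrefix (r.order w) ((r.order w).symm e + 1)) -
      M.f (itemPrefix (r.order w) ((r.order w).symm e)) := by
  unfold greedy
  congr 2
  · ext a
    simp only [Finset.mem_image, Finset.mem_Iic, mem_itemPrefix, Nat.lt_succ_iff, Fin.val_fin_le]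
    exact ⟨by rintro ⟨i, hi, rfl⟩; simpa using hi, fun h => ⟨_, h, by simp⟩⟩
  · ext a
    simp only [Finset.mem_image, Finset.mem_Iio, mem_itemPrefix, Fin.val_fin_lt]
    exact ⟨by rintro ⟨i, hi, rfl⟩; simpa using hi, fun h => ⟨_, h, by simp⟩⟩

/-- A sum over the items, each term of which is the increment of `g` at the position of the
item, telescopes. -/
lemma sum_increments (σ : Equiv.Perm (Fin L)) (g : ℕ → ℝ) :
    ∑ e, (g (σ.symm e + 1) - g (σ.symm e)) = g L - g 0 := by
  rw [Equiv.sum_comp σ.symm (fun i : Fin L => g (i + 1) - g i),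
    Fin.sum_univ_eq_sum_range (fun i => g (i + 1) - g i), Finset.sum_range_sub]

lemma greedy_nonneg (M : Polymatroid L) (r : SortRule L) (w : Fin L → ℝ) (e : Fin L) :
    0 ≤ greedy M r w e := by
  rw [greedy_eq]
  exact sub_nonneg.2 (M.mono _ _ (itemPrefix_mono _ (Nat.le_succ _)))

lemma sum_greedy (M : Polymatroid L) (r : SortRule L) (w : Fin L → ℝ) :
    ∑ e, greedy M r w e = M.rank := by
  simp_rw [greedy_eq]
  rw [sum_increments (r.order w) (fun k => M.f (itemPrefix (r.order w) k)), itemPrefix_zero,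
    itemPrefix_card, M.empty, sub_zero, Polymatroid.rank]

/-- Greedy bases lie in the base polytope: the marginal gain of an item decreases as the set it
is added to grows, so the gains of the items of `A` add up to at most `f A`. -/
lemma sum_greedy_le (M : Polymatroid L) (r : SortRule L) (w : Fin L → ℝ)
    (A : Finset (Fin L)) : ∑ e ∈ A, greedy M r w e ≤ M.f A := by
  classical
  set σ := r.order w
  have h := sum_increments σ (fun k => M.f (A ∩ itemPrefix σ k))
  simp only [itemPrefix_zero, itemPrefix_card, Finset.inter_empty, Finset.inter_univ, M.empty,
    sub_zero] at h
  rw [← h, ← Finset.sum_subset (Finset.subset_univ A)]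
  · refine Finset.sum_le_sum fun e he => ?_
    rw [greedy_eq]
    change M.f (itemPrefix σ _) - M.f (itemPrefix σ _) ≤ _
    have hs := M.submodular (A ∩ itemPrefix σ (σ.symm e + 1)) (itemPrefix σ (σ.symm e))
    have h1 : A ∩ itemPrefix σ (σ.symm e + 1) ∪ itemPrefix σ (σ.symm e) =
        itemPrefix σ (σ.symm e + 1) := by
      rw [itemPrefix_succ]; grind
    have h2 : A ∩ itemPrefix σ (σ.symm e + 1) ∩ itemPrefix σ (σ.symm e) =
        A ∩ itemPrefix σ (σ.symm e) := by
      rw [itemPrefix_succ]; grind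
    rw [h1, h2] at hs
    linarith
  · intro e _ he
    have : A ∩ itemPrefix σ (σ.symm e + 1) = A ∩ itemPrefix σ (σ.symm e) := by
      rw [itemPrefix_succ]; grind
    simp [this]

lemma greedy_le_one (M : Polymatroid L) (hM : ∀ e, M.f {e} ≤ 1) (r : SortRule L)
    (w : Fin L → ℝ) (e : Fin L) : greedy M r w e ≤ 1 := by
  simpa using (sum_greedy_le M r w {e}).trans (by simpa using hM e)

lemma rank_nonneg (M : Polymatroid L) : 0 ≤ M.rank := by
  have h := M.mono ∅ Finset.univ (Finset.empty_subset _)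
  rwa [M.empty] at h

lemma rank_le (M : Polymatroid L) (hM : ∀ e, M.f {e} ≤ 1) (r : SortRule L) :
    M.rank ≤ L := by
  rw [← sum_greedy M r 0]
  calc ∑ e, greedy M r 0 e ≤ ∑ _e : Fin L, (1 : ℝ) :=
        Finset.sum_le_sum fun e _ => greedy_le_one M hM r 0 e
    _ = L := by simp

lemma sum_itemPrefix_succ (σ : Equiv.Perm (Fin L)) (z : Fin L → ℝ) {k : ℕ} (hk : k < L) :
    ∑ e ∈ itemPrefix σ (k + 1), z e = ∑ e ∈ itemPrefix σ k, z e + z (σ ⟨k, hk⟩) := by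
  have h := itemPrefix_succ σ (σ ⟨k, hk⟩)
  simp only [Equiv.symm_apply_apply] at h
  rw [h, Finset.sum_insert (by simp), add_comm]

/-- The polymatroid constraints of the prefixes in the order of `w` are tight for its greedy
basis. -/
lemma sum_greedy_itemPrefix (M : Polymatroid L) (r : SortRule L) (w : Fin L → ℝ) {k : ℕ}
    (hk : k ≤ L) : ∑ e ∈ itemPrefix (r.order w) k, greedy M r w e =
      M.f (itemPrefix (r.order w) k) := by
  induction k with
  | zero => simp [itemPrefix_zero, M.empty]
  | succ k ih =>
    rw [sum_itemPrefix_succ _ _ hk, ih (by omega), greedy_eq]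
    simp

/-- Abel summation for a decreasing sequence of weights. -/
lemma mul_sum_le_sum_mul (a d : ℕ → ℝ) (n : ℕ) (ha : ∀ i < n, a (i + 1) ≤ a i)
    (hd : ∀ k ≤ n, 0 ≤ ∑ i ∈ Finset.range k, d i) :
    a n * ∑ i ∈ Finset.range (n + 1), d i ≤ ∑ i ∈ Finset.range (n + 1), a i * d i := by
  induction n with
  | zero => simp
  | succ n ih =>
    have h1 := ih (fun i hi => ha i (by omega)) (fun k hk => hd k (by omega))
    rw [Finset.sum_range_succ d, Finset.sum_range_succ _ (n + 1)]
    have h2 := mul_le_mul_of_nonneg_right (ha n (by omega)) (hd (n + 1) le_rfl)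
    linarith

/-- The greedy basis for `w` maximizes `⟨w, ·⟩` over all greedy bases. -/
theorem dotProduct_greedy_le (M : Polymatroid L) (r : SortRule L) (w v : Fin L → ℝ) :
    w ⬝ᵥ greedy M r v ≤ w ⬝ᵥ greedy M r w := by
  rcases Nat.eq_zero_or_pos L with rfl | hL
  · simp [dotProduct]
  set σ := r.order w with hσ
  set z : Fin L → ℝ := fun e => greedy M r w e - greedy M r v e with hz
  let a : ℕ → ℝ := fun i => if h : i < L then w (σ ⟨i, h⟩) else 0
  let d : ℕ → ℝ := fun i => if h : i < L then z (σ ⟨i, h⟩) else 0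
  have hsum : ∀ k ≤ L, ∑ i ∈ Finset.range k, d i = ∑ e ∈ itemPrefix σ k, z e := by
    intro k hk
    induction k with
    | zero => simp [itemPrefix_zero]
    | succ k ih =>
      rw [Finset.sum_range_succ, ih (by omega), sum_itemPrefix_succ _ _ hk]
      simp [d, Nat.lt_of_succ_le hk]
  have hall : ∑ i ∈ Finset.range L, d i = 0 := by
    rw [hsum L le_rfl, itemPrefix_card, Finset.sum_sub_distrib, sum_greedy, sum_greedy, sub_self]
  have key := mul_sum_le_sum_mul a d (L - 1) ?_ ?_
  · rw [Nat.sub_add_cancel hL, hall, mul_zero] at key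
    have : ∑ i ∈ Finset.range L, a i * d i = w ⬝ᵥ greedy M r w - w ⬝ᵥ greedy M r v := by
      rw [← Fin.sum_univ_eq_sum_range (fun i => a i * d i), ← dotProduct_sub, dotProduct,
        ← Equiv.sum_comp σ (fun e => w e * (greedy M r w - greedy M r v) e)]
      refine Finset.sum_congr rfl fun i _ => ?_
      simp [a, d, z]
    linarith
  · intro i hi
    have h1 : i < L := by omega
    have h2 : i + 1 < L := by omega
    simp only [a, h1, h2, dif_pos]
    exact r.sorted w (by simp)
  · intro k hk
    rw [hsum k (by omega), Finset.sum_sub_distrib, hσ, sum_greedy_itemPrefix M r w (by omega)]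
    exact sub_nonneg.2 (sum_greedy_le M r v _)

end Greedy

/-! ### Confidence radii and optimism along a run -/

section Potential

/-- If each `x t` is at most `1` and the counter `T`, which is at least `1` at the start, goes up
at every step with `0 < x t`, then `√(∑ x)` is a potential for the sum of `x t / √(T t)`: the
mass collected up to step `t` is at most `T t`. -/
lemma sum_div_sqrt_le (x : ℕ → ℝ) (T : ℕ → ℕ) (h0 : ∀ t, 0 ≤ x t) (h1 : ∀ t, x t ≤ 1)
    (hT0 : 1 ≤ T 0) (hT : ∀ t, T (t + 1) = if 0 < x t then T t + 1 else T t) (n : ℕ) :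
    ∑ t ∈ Finset.range n, x t / √(T t) ≤ 2 * √(∑ t ∈ Finset.range n, x t) := by
  have hmass : ∀ n, ∑ t ∈ Finset.range n, x t + 1 ≤ T n := by
    intro n
    induction n with
    | zero => simpa using hT0
    | succ n ih =>
      rw [Finset.sum_range_succ, hT]
      split_ifs with h
      · push_cast; linarith [h1 n]
      · linarith
  induction n with
  | zero => simp
  | succ n ih =>
    rw [Finset.sum_range_succ, Finset.sum_range_succ x]
    have hS : 0 ≤ ∑ t ∈ Finset.range n, x t := Finset.sum_nonneg fun t _ => h0 t
    set S := ∑ t ∈ Finset.range n, x t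
    rcases (h0 n).eq_or_lt with hx | hx
    · simpa [← hx] using ih
    · have hpos : 0 < √(S + x n) := Real.sqrt_pos.2 (by linarith)
      have hle : √(S + x n) ≤ √(T n) := Real.sqrt_le_sqrt (by linarith [hmass n, h1 n])
      have hx' : x n / √(T n) ≤ x n / √(S + x n) := by gcongr
      -- With `a = √S` and `b = √(S + x)`, `x / b = (b² - a²) / b ≤ 2 (b - a)`.
      have hstep : x n / √(S + x n) ≤ 2 * (√(S + x n) - √S) := by
        rw [div_le_iff₀ hpos]
        nlinarith [Real.sq_sqrt hS, Real.sq_sqrt (show 0 ≤ S + x n by linarith),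
          sq_nonneg (√(S + x n) - √S)]
      linarith

end Potential

section Run

variable {L : ℕ} (M : Polymatroid L) (r : SortRule L) (w : ℕ → Fin L → ℝ)

lemma opmState_T_succ (t : ℕ) (e : Fin L) :
    (opmState M r w (t + 1)).T e =
      if 0 < opmBasis M r w t e then (opmState M r w t).T e + 1 else (opmState M r w t).T e :=
  rfl

lemma one_le_opmState_T (t : ℕ) (e : Fin L) : 1 ≤ (opmState M r w t).T e := by
  induction t with
  | zero => exact le_rfl
  | succ t ih => rw [opmState_T_succ]; split_ifs <;> omega

lemma opmState_T_le (t : ℕ) (e : Fin L) : (opmState M r w t).T e ≤ t + 1 := by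
  induction t with
  | zero => exact le_rfl
  | succ t ih => rw [opmState_T_succ]; split_ifs <;> omega

lemma opmBasis_nonneg (t : ℕ) (e : Fin L) : 0 ≤ opmBasis M r w t e :=
  greedy_nonneg M r _ e

lemma sum_opmBasis (t : ℕ) : ∑ e, opmBasis M r w t e = M.rank :=
  sum_greedy M r _

/-- The confidence radii of the chosen items, weighted by the chosen bases, add up to
`O(√(K L n log n))` along every run. -/
theorem sum_radius_le (hM : ∀ e, M.f {e} ≤ 1) (n : ℕ) :
    ∑ t ∈ Finset.range n, ∑ e, opmBasis M r w t e * radius t ((opmState M r w t).T e) ≤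
      4 * √(M.rank * L * n * Real.log n) := by
  have hle : ∀ t ∈ Finset.range n, ∀ e,
      opmBasis M r w t e * radius t ((opmState M r w t).T e) ≤
        √(2 * Real.log n) * (opmBasis M r w t e / √((opmState M r w t).T e)) := by
    intro t ht e
    have hlog : Real.log t ≤ Real.log n := by
      rcases Nat.eq_zero_or_pos t with rfl | h
      · simpa using Real.log_natCast_nonneg n
      · exact Real.log_le_log (by exact_mod_cast h)
          (by exact_mod_cast (Finset.mem_range.1 ht).le)
    have h1 : radius t ((opmState M r w t).T e) ≤
        √(2 * Real.log n) / √((opmState M r w t).T e) := by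
      rw [radius, Real.sqrt_div (by have := Real.log_natCast_nonneg t; positivity)]
      gcongr
    calc _ ≤ opmBasis M r w t e * (√(2 * Real.log n) / √((opmState M r w t).T e)) :=
          mul_le_mul_of_nonneg_left h1 (opmBasis_nonneg M r w t e)
      _ = _ := by ring
  set X : Fin L → ℝ := fun e => ∑ t ∈ Finset.range n, opmBasis M r w t e
  have hX0 : ∀ e, 0 ≤ X e := fun e => Finset.sum_nonneg fun t _ => opmBasis_nonneg M r w t e
  have hXsum : ∑ e, X e = n * M.rank := by
    rw [Finset.sum_comm]
    simp [sum_opmBasis]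
  have hlog0 := Real.log_natCast_nonneg n
  have hK := rank_nonneg M
  calc _ ≤ ∑ t ∈ Finset.range n, ∑ e,
        √(2 * Real.log n) * (opmBasis M r w t e / √((opmState M r w t).T e)) :=
        Finset.sum_le_sum fun t ht => Finset.sum_le_sum fun e _ => hle t ht e
    _ = √(2 * Real.log n) * ∑ e, ∑ t ∈ Finset.range n,
          opmBasis M r w t e / √((opmState M r w t).T e) := by
        rw [Finset.sum_comm]
        simp_rw [Finset.mul_sum]
    _ ≤ √(2 * Real.log n) * ∑ e, 2 * √(X e) := by
        gcongr with e
        exact sum_div_sqrt_le (fun t => opmBasis M r w t e) (fun t => (opmState M r w t).T e)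
          (fun t => opmBasis_nonneg M r w t e) (fun t => greedy_le_one M hM r _ e)
          (one_le_opmState_T M r w 0 e) (fun t => opmState_T_succ M r w t e) n
    _ ≤ √(2 * Real.log n) * (2 * √(L * (n * M.rank))) := by
        rw [← Finset.mul_sum, ← hXsum]
        gcongr
        refine Real.le_sqrt_of_sq_le ?_
        have h := sq_sum_le_card_mul_sum_sq (s := Finset.univ) (f := fun e => √(X e))
        simpa [Real.sq_sqrt (hX0 _)] using h
    _ = 2 * √2 * √(M.rank * L * n * Real.log n) := by
        rw [show M.rank * L * n * Real.log n = Real.log n * (L * (n * M.rank)) by ring,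
          Real.sqrt_mul zero_le_two, Real.sqrt_mul hlog0]
        ring
    _ ≤ 4 * √(M.rank * L * n * Real.log n) := by
        gcongr
        nlinarith [Real.sq_sqrt (zero_le_two (α := ℝ)), Real.sqrt_nonneg 2]

/-- After episode `t`, some estimate is farther from its mean in `m` than its confidence radius. -/
def EstimateFails (m : Fin L → ℝ) (t : ℕ) : Prop :=
  ∃ e, radius t ((opmState M r w t).T e) < |(opmState M r w t).est e - m e|

open Classical in
/-- Optimism: as long as the estimates are within their confidence radii, the gap of the chosen
basis is at most twice the sum of the radii of its items. -/
theorem gap_le {m xstar : Fin L → ℝ} (hm : ∀ e, m e ∈ Set.Icc (0 : ℝ) 1)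
    (hx : xstar ∈ feasible M r) (t : ℕ) :
    m ⬝ᵥ xstar - m ⬝ᵥ opmBasis M r w t ≤
      2 * ∑ e, opmBasis M r w t e * radius t ((opmState M r w t).T e) +
        M.rank * (if EstimateFails M r w m t then 1 else 0) := by
  obtain ⟨v, -, rfl⟩ := hx
  have hx0 := opmBasis_nonneg M r w t
  split_ifs with hbad
  · have h1 : m ⬝ᵥ greedy M r v ≤ M.rank := by
      rw [← sum_greedy M r v]
      exact Finset.sum_le_sum fun e _ =>
        mul_le_of_le_one_left (greedy_nonneg M r v e) (hm e).2
    have h2 : 0 ≤ m ⬝ᵥ opmBasis M r w t :=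
      Finset.sum_nonneg fun e _ => mul_nonneg (hm e).1 (hx0 e)
    have h3 : 0 ≤ ∑ e, opmBasis M r w t e * radius t ((opmState M r w t).T e) :=
      Finset.sum_nonneg fun e _ => mul_nonneg (hx0 e) (Real.sqrt_nonneg _)
    linarith
  · simp only [EstimateFails, not_exists, not_lt] at hbad
    set U := ucb t (opmState M r w t) with hU
    have h1 : m ⬝ᵥ greedy M r v ≤ U ⬝ᵥ greedy M r v :=
      Finset.sum_le_sum fun e _ => mul_le_mul_of_nonneg_right
        (by have := (abs_le.1 (hbad e)).1; simp only [hU, ucb]; linarith) (greedy_nonneg M r v e)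
    have h2 : U ⬝ᵥ greedy M r v ≤ U ⬝ᵥ opmBasis M r w t := dotProduct_greedy_le M r U v
    have h3 : U ⬝ᵥ opmBasis M r w t - m ⬝ᵥ opmBasis M r w t ≤
        2 * ∑ e, opmBasis M r w t e * radius t ((opmState M r w t).T e) := by
      rw [← sub_dotProduct, Finset.mul_sum]
      refine Finset.sum_le_sum fun e _ => ?_
      have h4 : (U - m) e ≤ 2 * radius t ((opmState M r w t).T e) := by
        have := (abs_le.1 (hbad e)).2
        simp only [hU, ucb, Pi.sub_apply]
        linarith
      nlinarith [mul_le_mul_of_nonneg_right h4 (hx0 e)]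
    linarith

end Run

/-! ### Measurability of the run -/

section Measurability

variable {L : ℕ} (M : Polymatroid L) (r : SortRule L)

lemma measurable_greedy (e : Fin L) : Measurable fun v => greedy M r v e := by
  let _ : MeasurableSpace (Equiv.Perm (Fin L)) := ⊤
  have h : Measurable r.order := measurable_to_countable' fun σ => r.measurable σ
  have hg : Measurable fun σ : Equiv.Perm (Fin L) =>
      M.f ((Finset.Iic (σ.symm e)).image σ) - M.f ((Finset.Iio (σ.symm e)).image σ) :=
    measurable_from_top
  exact hg.comp h

lemma measurable_radius (t : ℕ) : Measurable (radius t) := measurable_from_nat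

lemma measurable_opmBasis_of_opmState {Ω : Type*} [MeasurableSpace Ω] (w : ℕ → Ω → Fin L → ℝ)
    (t : ℕ)
    (h : ∀ e, Measurable (fun ω => (opmState M r (fun i => w i ω) t).T e) ∧
      Measurable fun ω => (opmState M r (fun i => w i ω) t).est e) (e : Fin L) :
    Measurable fun ω => opmBasis M r (fun i => w i ω) t e := by
  refine (measurable_greedy M r e).comp (measurable_pi_lambda _ fun a => ?_)
  exact (h a).2.add ((measurable_radius t).comp (h a).1)

/-- The statistics after episode `t` are measurable functions of `w 0, …, w t`. -/
lemma measurable_opmState {Ω : Type*} [MeasurableSpace Ω] (w : ℕ → Ω → Fin L → ℝ) (t : ℕ)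
    (hw : ∀ i ≤ t, Measurable (w i)) (e : Fin L) :
    Measurable (fun ω => (opmState M r (fun i => w i ω) t).T e) ∧
      Measurable fun ω => (opmState M r (fun i => w i ω) t).est e := by
  induction t generalizing e with
  | zero => exact ⟨measurable_const, measurable_pi_iff.1 (hw 0 le_rfl) e⟩
  | succ t ih =>
    have ih' := ih fun i hi => hw i (by omega)
    have hset : MeasurableSet {ω | 0 < opmBasis M r (fun i => w i ω) t e} :=
      measurableSet_lt measurable_const (measurable_opmBasis_of_opmState M r w t ih' e)
    have hT := (ih' e).1
    have hest := (ih' e).2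
    have hv := measurable_pi_iff.1 (hw (t + 1) le_rfl) e
    have hT' : Measurable fun ω => ((opmState M r (fun i => w i ω) t).T e : ℝ) :=
      measurable_from_nat.comp hT
    exact ⟨Measurable.ite hset (hT.add_const 1) hT,
      Measurable.ite hset (((hT'.mul hest).add hv).div (hT'.add_const 1)) hest⟩

lemma measurable_opmBasis {Ω : Type*} [MeasurableSpace Ω] (w : ℕ → Ω → Fin L → ℝ) (t : ℕ)
    (hw : ∀ i ≤ t, Measurable (w i)) (e : Fin L) :
    Measurable fun ω => opmBasis M r (fun i => w i ω) t e :=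
  measurable_opmBasis_of_opmState M r w t (measurable_opmState M r w t hw) e

end Measurability

/-! ### Concentration of the estimates -/

section Concentration

variable {L : ℕ} {Ω : Type*} [MeasurableSpace Ω] {μ : Measure Ω} {w : ℕ → Ω → (Fin L → ℝ)}

/-- The information contained in `w 0, …, w t`. -/
abbrev past (hw : ∀ t, Measurable (w t)) (t : ℕ) : MeasurableSpace Ω :=
  Filtration.natural w (fun t => (hw t).stronglyMeasurable) t

lemma past_le (hw : ∀ t, Measurable (w t)) (t : ℕ) : past hw t ≤ ‹MeasurableSpace Ω› :=
  (Filtration.natural w fun t => (hw t).stronglyMeasurable).le t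

lemma measurable_past (hw : ∀ t, Measurable (w t)) {i t : ℕ} (hi : i ≤ t) :
    Measurable[past hw t] (w i) :=
  Measurable.of_comap_le
    (le_iSup₂_of_le (f := fun j (_ : j ≤ t) => MeasurableSpace.comap (w j) _) i hi le_rfl)

/-- The weights of the next episode are independent of the past. -/
lemma indepFun_of_measurable_past (hw : ∀ t, Measurable (w t)) (hind : iIndepFun w μ) {t : ℕ}
    {β : Type*} [MeasurableSpace β] {g : Ω → β} (hg : Measurable[past hw t] g) :
    IndepFun g (w (t + 1)) μ := by
  rw [IndepFun_iff_Indep]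
  exact indep_of_indep_of_le_left
    (hind.indep_comap_natural_of_lt (fun t => (hw t).stronglyMeasurable) t.lt_succ_self).symm
    hg.comap_le

/-- Hoeffding's lemma for variables in `[0, 1]`. -/
lemma lintegral_exp_le_one [IsProbabilityMeasure μ] {X : Ω → ℝ} (hX : Measurable X)
    (hb : ∀ᵐ ω ∂μ, X ω ∈ Set.Icc (0 : ℝ) 1) (a : ℝ) :
    ∫⁻ ω, ENNReal.ofReal (Real.exp (a * (X ω - μ[X]) - a ^ 2 / 8)) ∂μ ≤ 1 := by
  have h := hasSubgaussianMGF_of_mem_Icc hX.aemeasurable hb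
  have hint : Integrable (fun ω => Real.exp (a * (X ω - μ[X]) - a ^ 2 / 8)) μ := by
    simp_rw [Real.exp_sub]
    exact (h.integrable_exp_mul a).div_const _
  rw [← ofReal_integral_eq_lintegral_ofReal hint (ae_of_all _ fun _ => (Real.exp_pos _).le)]
  refine ENNReal.ofReal_le_one.2 ?_
  simp_rw [Real.exp_sub]
  rw [integral_div, div_le_one (Real.exp_pos _)]
  refine (h.mgf_le a).trans (Real.exp_le_exp.2 (le_of_eq ?_))
  simp
  ring

/-- The exponential of the centred sum of the observed weights of item `e`, compensated by the
number of observations. -/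
noncomputable def expDeviation (M : Polymatroid L) (r : SortRule L) (m : Fin L → ℝ) (e : Fin L)
    (a : ℝ) (v : ℕ → Fin L → ℝ) (t : ℕ) : ℝ :=
  Real.exp (a * ((opmState M r v t).T e * ((opmState M r v t).est e - m e)) -
    (opmState M r v t).T e * (a ^ 2 / 8))

variable (M : Polymatroid L) (r : SortRule L) (m : Fin L → ℝ) (e : Fin L) (a : ℝ)

lemma expDeviation_zero (v : ℕ → Fin L → ℝ) :
    expDeviation M r m e a v 0 = Real.exp (a * (v 0 e - m e) - a ^ 2 / 8) := by
  simp [expDeviation, opmState]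

lemma expDeviation_succ (v : ℕ → Fin L → ℝ) (t : ℕ) :
    expDeviation M r m e a v (t + 1) = if 0 < opmBasis M r v t e then
      expDeviation M r m e a v t * Real.exp (a * (v (t + 1) e - m e) - a ^ 2 / 8) else
      expDeviation M r m e a v t := by
  have hT : (opmState M r v (t + 1)).T e = _ := opmState_T_succ M r v t e
  have hest : (opmState M r v (t + 1)).est e = if 0 < opmBasis M r v t e then
      (((opmState M r v t).T e : ℝ) * (opmState M r v t).est e + v (t + 1) e) /
        (((opmState M r v t).T e : ℝ) + 1) else (opmState M r v t).est e := rfl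
  simp only [expDeviation, hT, hest]
  split_ifs with h
  · rw [← Real.exp_add]
    congr 1
    have : ((opmState M r v t).T e : ℝ) + 1 ≠ 0 := by positivity
    push_cast
    field_simp
    ring
  · rfl

lemma measurable_expDeviation {Ω : Type*} [MeasurableSpace Ω] (w : ℕ → Ω → Fin L → ℝ) (t : ℕ)
    (hw : ∀ i ≤ t, Measurable (w i)) :
    Measurable fun ω => expDeviation M r m e a (fun i => w i ω) t := by
  obtain ⟨hT, hest⟩ := measurable_opmState M r w t hw e
  have hT' : Measurable fun ω => ((opmState M r (fun i => w i ω) t).T e : ℝ) :=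
    measurable_from_nat.comp hT
  unfold expDeviation
  exact Real.measurable_exp.comp
    (((hT'.mul (hest.sub_const _)).const_mul a).sub (hT'.mul_const _))

/-- Whether item `e` is observed depends on the past only, so `expDeviation` is a nonnegative
supermartingale, and its expectation stays at most `1`. -/
lemma lintegral_expDeviation_le_one [IsProbabilityMeasure μ] (hw : ∀ t, Measurable (w t))
    (hind : iIndepFun w μ) (hb : ∀ t, ∀ᵐ ω ∂μ, w t ω e ∈ Set.Icc (0 : ℝ) 1)
    (hm : ∀ t, ∫ ω, w t ω e ∂μ = m e) (t : ℕ) :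
    ∫⁻ ω, ENNReal.ofReal (expDeviation M r m e a (fun i => w i ω) t) ∂μ ≤ 1 := by
  have hstep : ∀ t, ∫⁻ ω, ENNReal.ofReal (Real.exp (a * (w t ω e - m e) - a ^ 2 / 8)) ∂μ ≤ 1 := by
    intro t
    have := lintegral_exp_le_one (measurable_pi_iff.1 (hw t) e) (hb t) a
    rwa [hm] at this
  induction t with
  | zero => simpa only [expDeviation_zero] using hstep 0
  | succ t ih =>
    set G : Ω → ENNReal := fun ω => ENNReal.ofReal (expDeviation M r m e a (fun i => w i ω) t)
    set A : Set Ω := {ω | 0 < opmBasis M r (fun i => w i ω) t e}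
    set φ : (Fin L → ℝ) → ENNReal := fun v =>
      ENNReal.ofReal (Real.exp (a * (v e - m e) - a ^ 2 / 8))
    have hG : Measurable[past hw t] G :=
      ENNReal.measurable_ofReal.comp (@measurable_expDeviation L M r m e a Ω (past hw t) w t
        fun i hi => measurable_past hw hi)
    have hA : MeasurableSet[past hw t] A :=
      @measurable_opmBasis L M r Ω (past hw t) w t (fun i hi => measurable_past hw hi) e _
        measurableSet_Ioi
    have hGA : Measurable[past hw t] (A.indicator G) :=
      hG.indicator hA
    have hA' : MeasurableSet A := past_le hw t _ hA
    have hφ : Measurable φ := by fun_prop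
    have hsplit : ∀ ω, ENNReal.ofReal (expDeviation M r m e a (fun i => w i ω) (t + 1)) =
        A.indicator G ω * φ (w (t + 1) ω) + Aᶜ.indicator G ω := by
      intro ω
      rw [expDeviation_succ]
      by_cases h : 0 < opmBasis M r (fun i => w i ω) t e
      · rw [if_pos h, Set.indicator_of_mem (show ω ∈ A from h),
          Set.indicator_of_notMem (show ω ∉ Aᶜ from not_not.2 h), add_zero]
        exact ENNReal.ofReal_mul (Real.exp_pos _).le
      · rw [if_neg h, Set.indicator_of_notMem (show ω ∉ A from h),
          Set.indicator_of_mem (show ω ∈ Aᶜ from h), zero_mul, zero_add]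
    have hmul : ∫⁻ ω, A.indicator G ω * φ (w (t + 1) ω) ∂μ ≤ ∫⁻ ω, A.indicator G ω ∂μ := by
      have hi : IndepFun (A.indicator G) (fun ω => φ (w (t + 1) ω)) μ :=
        (indepFun_of_measurable_past hw hind hGA).comp measurable_id hφ
      refine (lintegral_mul_eq_lintegral_mul_lintegral_of_indepFun''
        (hGA.mono (past_le hw t) le_rfl).aemeasurable (hφ.comp (hw _)).aemeasurable hi).trans_le ?_
      exact mul_le_of_le_one_right' (hstep (t + 1))
    calc _ = ∫⁻ ω, A.indicator G ω * φ (w (t + 1) ω) + Aᶜ.indicator G ω ∂μ :=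
          lintegral_congr hsplit
      _ = ∫⁻ ω, A.indicator G ω * φ (w (t + 1) ω) ∂μ + ∫⁻ ω, Aᶜ.indicator G ω ∂μ :=
          lintegral_add_left ((hGA.mono (past_le hw t) le_rfl).mul (hφ.comp (hw _))) _
      _ ≤ ∫⁻ ω, A.indicator G ω ∂μ + ∫⁻ ω, Aᶜ.indicator G ω ∂μ := by gcongr
      _ = ∫⁻ ω, G ω ∂μ := by
          rw [lintegral_indicator hA', lintegral_indicator hA'.compl,
            lintegral_add_compl _ hA']
      _ ≤ 1 := ih

/-- The Chernoff bound for one direction `σ` of the deviation, on the event that there are exactly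
`s` observations. -/
lemma measure_deviation_le [IsProbabilityMeasure μ] (hw : ∀ t, Measurable (w t))
    (hind : iIndepFun w μ) (hb : ∀ t, ∀ᵐ ω ∂μ, w t ω e ∈ Set.Icc (0 : ℝ) 1)
    (hm : ∀ t, ∫ ω, w t ω e ∂μ = m e) {t s : ℕ} (ht : 1 ≤ t) (hs : 1 ≤ s) {σ : ℝ}
    (hσ : σ ^ 2 = 1) :
    μ {ω | (opmState M r (fun i => w i ω) t).T e = s ∧
      radius t s < σ * ((opmState M r (fun i => w i ω) t).est e - m e)} ≤
      ENNReal.ofReal (1 / (t : ℝ) ^ 4) := by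
  set ε := radius t s with hε
  have hs' : (0 : ℝ) < s := by exact_mod_cast hs
  have ht' : (0 : ℝ) < t := by exact_mod_cast ht
  have hε2 : s * ε ^ 2 = 2 * Real.log t := by
    rw [hε, radius, Real.sq_sqrt (by have := Real.log_natCast_nonneg t; positivity)]
    field_simp
  have hε0 : 0 ≤ ε := Real.sqrt_nonneg _
  have hmarkov := (mul_meas_ge_le_lintegral₀ (ENNReal.measurable_ofReal.comp
    (measurable_expDeviation M r m e (4 * ε * σ) w t fun i _ => hw i)).aemeasurable
    (ENNReal.ofReal ((t : ℝ) ^ 4))).trans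
    (lintegral_expDeviation_le_one M r m e (4 * ε * σ) hw hind hb hm t)
  rw [one_div, ENNReal.ofReal_inv_of_pos (by positivity), ENNReal.le_inv_iff_mul_le, mul_comm]
  refine le_trans (mul_le_mul' le_rfl (measure_mono ?_)) hmarkov
  rintro ω ⟨hT, hdev⟩
  -- With `a = 4 ε σ` the exponent is at least `4 s ε² - 2 s ε² = 2 s ε² = 4 log t`.
  refine ENNReal.ofReal_le_ofReal ?_
  simp only [expDeviation]
  rw [hT, ← Real.rpow_natCast, Real.rpow_def_of_pos ht', Real.exp_le_exp]
  have h1 : s * ε * ε ≤ s * ε * (σ * ((opmState M r (fun i => w i ω) t).est e - m e)) := by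
    gcongr
  have h2 : (4 * ε * σ) ^ 2 = 16 * ε ^ 2 := by rw [mul_pow, hσ]; ring
  rw [h2]
  push_cast
  nlinarith

/-- The estimates leave their confidence intervals after episode `t` with probability `O(L / t²)`;
the union bound runs over the items, the possible numbers of observations and the two directions
of the deviation. -/
theorem measure_estimateFails_le [IsProbabilityMeasure μ] (hw : ∀ t, Measurable (w t))
    (hind : iIndepFun w μ) (hb : ∀ e t, ∀ᵐ ω ∂μ, w t ω e ∈ Set.Icc (0 : ℝ) 1)
    (hm : ∀ e t, ∫ ω, w t ω e ∂μ = m e) {t : ℕ} (ht : 1 ≤ t) :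
    μ.real {ω | EstimateFails M r (fun i => w i ω) m t} ≤ L * (4 / (t : ℝ) ^ 2) := by
  let B : Fin L → ℕ → ℝ → Set Ω := fun e s σ =>
    {ω | (opmState M r (fun i => w i ω) t).T e = s ∧
      radius t s < σ * ((opmState M r (fun i => w i ω) t).est e - m e)}
  have hB : ∀ e, ∀ s ∈ Finset.Icc 1 (t + 1), ∀ σ : ℝ, σ ^ 2 = 1 →
      μ.real (B e s σ) ≤ 1 / (t : ℝ) ^ 4 := fun e s hs σ hσ =>
    ENNReal.toReal_le_of_le_ofReal (by positivity)
      (measure_deviation_le M r m e hw hind (hb e) (hm e) ht (Finset.mem_Icc.1 hs).1 hσ)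
  have hsub : {ω | EstimateFails M r (fun i => w i ω) m t} ⊆
      ⋃ e ∈ (Finset.univ : Finset (Fin L)), ⋃ s ∈ Finset.Icc 1 (t + 1),
        (B e s 1 ∪ B e s (-1)) := by
    rintro ω ⟨e, he⟩
    simp only [Set.mem_iUnion, Finset.mem_Icc, exists_prop]
    refine ⟨e, Finset.mem_univ _, _, ⟨one_le_opmState_T M r (fun i => w i ω) t e,
      opmState_T_le M r (fun i => w i ω) t e⟩, ?_⟩
    rcases lt_abs.1 he with h | h
    · exact Or.inl ⟨rfl, by simpa using h⟩
    · exact Or.inr ⟨rfl, by simpa using h⟩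
  have ht' : (1 : ℝ) ≤ t := by exact_mod_cast ht
  calc μ.real {ω | EstimateFails M r (fun i => w i ω) m t}
      ≤ ∑ e : Fin L, ∑ s ∈ Finset.Icc 1 (t + 1), (μ.real (B e s 1) + μ.real (B e s (-1))) := by
        refine (measureReal_mono hsub (measure_ne_top _ _)).trans
          ((measureReal_biUnion_finset_le _ _).trans ?_)
        refine Finset.sum_le_sum fun e _ => (measureReal_biUnion_finset_le _ _).trans ?_
        exact Finset.sum_le_sum fun s _ => measureReal_union_le _ _
    _ ≤ ∑ e : Fin L, ∑ s ∈ Finset.Icc 1 (t + 1), (1 / (t : ℝ) ^ 4 + 1 / (t : ℝ) ^ 4) := by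
        gcongr with e _ s hs
        · exact hB e s hs 1 (by norm_num)
        · exact hB e s hs (-1) (by norm_num)
    _ = L * ((t + 1) * (2 / (t : ℝ) ^ 4)) := by
        simp; ring
    _ ≤ L * (4 / (t : ℝ) ^ 2) := by
        gcongr
        rw [← mul_div_assoc, div_le_div_iff₀ (by positivity) (by positivity)]
        have h : (t : ℝ) + 1 ≤ 2 * (t : ℝ) ^ 2 := by nlinarith
        nlinarith [mul_le_mul_of_nonneg_right h (sq_nonneg (t : ℝ))]

end Concentration

/-! ### Expected regret -/

section Regret

variable {L : ℕ} {Ω : Type*} [MeasurableSpace Ω] {μ : Measure Ω} {w : ℕ → Ω → (Fin L → ℝ)}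

/-- The chosen basis depends on the past only, so in expectation the weights of an episode may be
replaced by their means. -/
lemma integral_gap [IsProbabilityMeasure μ] (M : Polymatroid L) (hM : ∀ e, M.f {e} ≤ 1)
    (r : SortRule L) (hw : ∀ t, Measurable (w t)) (hind : iIndepFun w μ)
    (hint : ∀ e t, Integrable (fun ω => w t ω e) μ) {m : Fin L → ℝ}
    (hm : ∀ e t, ∫ ω, w t ω e ∂μ = m e) (x : Fin L → ℝ) (t : ℕ) :
    Integrable (fun ω => w (t + 1) ω ⬝ᵥ x -
        w (t + 1) ω ⬝ᵥ opmBasis M r (fun i => w i ω) t) μ ∧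
      Integrable (fun ω => m ⬝ᵥ x - m ⬝ᵥ opmBasis M r (fun i => w i ω) t) μ ∧
      ∫ ω, (w (t + 1) ω ⬝ᵥ x - w (t + 1) ω ⬝ᵥ opmBasis M r (fun i => w i ω) t) ∂μ =
        ∫ ω, (m ⬝ᵥ x - m ⬝ᵥ opmBasis M r (fun i => w i ω) t) ∂μ := by
  simp_rw [← dotProduct_sub]
  set d : Fin L → Ω → ℝ := fun e ω => x e - opmBasis M r (fun i => w i ω) t e
  have hdmeas : ∀ e, Measurable[past hw t] (d e) := fun e =>
    (@measurable_opmBasis L M r Ω (past hw t) w t (fun i hi => measurable_past hw hi) e).const_sub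
      (x e)
  have hdint : ∀ e, Integrable (d e) μ := fun e =>
    (integrable_const (x e)).sub (Integrable.of_mem_Icc 0 1
      (measurable_opmBasis M r w t (fun i _ => hw i) e).aemeasurable
      (ae_of_all _ fun ω => ⟨opmBasis_nonneg M r _ t e, greedy_le_one M hM r _ e⟩))
  have hi : ∀ e, IndepFun (fun ω => w (t + 1) ω e) (d e) μ := fun e =>
    ((indepFun_of_measurable_past hw hind (hdmeas e)).comp measurable_id
      (measurable_pi_apply e)).symm
  have h1 : ∀ e, Integrable (fun ω => w (t + 1) ω e * d e ω) μ := fun e =>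
    (hi e).integrable_mul (hint e (t + 1)) (hdint e)
  have h2 : ∀ e, Integrable (fun ω => m e * d e ω) μ := fun e => (hdint e).const_mul _
  refine ⟨integrable_finsetSum _ fun e _ => h1 e, integrable_finsetSum _ fun e _ => h2 e, ?_⟩
  change ∫ ω, ∑ e, w (t + 1) ω e * d e ω ∂μ = ∫ ω, ∑ e, m e * d e ω ∂μ
  rw [integral_finsetSum _ fun e _ => h1 e, integral_finsetSum _ fun e _ => h2 e]
  refine Finset.sum_congr rfl fun e _ => ?_
  rw [integral_const_mul, ← hm e (t + 1)]
  exact (hi e).integral_mul_eq_mul_integral (hint e (t + 1)).aestronglyMeasurable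
    (hdint e).aestronglyMeasurable

/-- The episodes in which some estimate fails cost at most `(4/3) π² L²` in expectation: in the
first one the bound is `K ≤ L`, and the probabilities of the later failures are summable. -/
lemma rank_mul_sum_le (M : Polymatroid L) (hM : ∀ e, M.f {e} ≤ 1) (r : SortRule L) (p : ℕ → ℝ)
    (hp0 : p 0 ≤ 1) (hp : ∀ t, 1 ≤ t → p t ≤ L * (4 / (t : ℝ) ^ 2)) (n : ℕ) :
    M.rank * ∑ t ∈ Finset.range n, p t ≤ 4 / 3 * Real.pi ^ 2 * (L : ℝ) ^ 2 := by
  have hK := rank_nonneg M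
  have hKL := rank_le M hM r
  have hz : ∑ t ∈ Finset.range n, (1 : ℝ) / (t : ℝ) ^ 2 ≤ Real.pi ^ 2 / 6 :=
    sum_le_hasSum _ (fun t _ => by positivity) hasSum_zeta_two
  have hsum : ∑ t ∈ Finset.range n, p t ≤ 1 + L * 4 * (Real.pi ^ 2 / 6) := by
    calc ∑ t ∈ Finset.range n, p t
        ≤ ∑ t ∈ Finset.range n, ((if t = 0 then 1 else 0) + L * 4 * (1 / (t : ℝ) ^ 2)) := by
          refine Finset.sum_le_sum fun t _ => ?_
          rcases Nat.eq_zero_or_pos t with rfl | ht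
          · simpa using hp0
          · rw [if_neg ht.ne', zero_add]
            exact (hp t ht).trans (le_of_eq (by ring))
      _ ≤ 1 + L * 4 * (Real.pi ^ 2 / 6) := by
          rw [Finset.sum_add_distrib, ← Finset.mul_sum]
          gcongr
          rw [Finset.sum_ite_eq']
          split_ifs <;> norm_num
  have hL : (L : ℝ) ≤ (L : ℝ) ^ 2 := by exact_mod_cast Nat.le_self_pow two_ne_zero L
  have hpi : 9 ≤ Real.pi ^ 2 := by nlinarith [Real.pi_gt_three]
  calc M.rank * ∑ t ∈ Finset.range n, p t ≤ L * (1 + L * 4 * (Real.pi ^ 2 / 6)) := by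
        refine (mul_le_mul_of_nonneg_left hsum hK).trans ?_
        gcongr
    _ ≤ 4 / 3 * Real.pi ^ 2 * (L : ℝ) ^ 2 := by
        nlinarith [mul_le_mul_of_nonneg_right hpi (sq_nonneg (L : ℝ))]

end Regret

end PolymatroidBandit

theorem mainTheorem2 {L : ℕ} (M : Polymatroid L) (hM : ∀ e : Fin L, M.f {e} ≤ 1)
    (r : SortRule L)
    (P : Measure (Fin L → ℝ)) [IsProbabilityMeasure P]
    (hP : ∀ᵐ v ∂P, ∀ e, v e ∈ Set.Icc (0 : ℝ) 1)
    {Ω : Type*} [MeasurableSpace Ω] (μ : Measure Ω) [IsProbabilityMeasure μ]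
    (w : ℕ → Ω → (Fin L → ℝ)) (hw_meas : ∀ t, Measurable (w t))
    (hw_law : ∀ t, μ.map (w t) = P) (hw_indep : iIndepFun w μ)
    (xstar : Fin L → ℝ) (hxstar : IsOptimal M r P xstar)
    (n : ℕ) (hn : 1 ≤ n) :
    Integrable (fun ω => regret M r xstar (fun t => w t ω) n) μ ∧
      ∫ ω, regret M r xstar (fun t => w t ω) n ∂μ ≤
        8 * Real.sqrt (M.rank * L * n * Real.log n) + 4 / 3 * Real.pi ^ 2 * (L : ℝ) ^ 2 := by
  classical
  set m := meanWeight P with hmdef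
  have hb : ∀ e t, ∀ᵐ ω ∂μ, w t ω e ∈ Set.Icc (0 : ℝ) 1 := by
    intro e t
    have h := hP
    rw [← hw_law t] at h
    filter_upwards [ae_of_ae_map (hw_meas t).aemeasurable h] with ω hω using hω e
  have hmeas : ∀ e t, Measurable fun ω => w t ω e := fun e t =>
    measurable_pi_iff.1 (hw_meas t) e
  have hint : ∀ e t, Integrable (fun ω => w t ω e) μ := fun e t =>
    Integrable.of_mem_Icc 0 1 (hmeas e t).aemeasurable (hb e t)
  have hm : ∀ e t, ∫ ω, w t ω e ∂μ = m e := by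
    intro e t
    rw [hmdef, meanWeight, ← hw_law t, integral_map (hw_meas t).aemeasurable
      (measurable_pi_apply e).aestronglyMeasurable]
  have hm01 : ∀ e, m e ∈ Set.Icc (0 : ℝ) 1 := by
    intro e
    rw [← hm e 0]
    refine ⟨integral_nonneg_of_ae ((hb e 0).mono fun ω h => h.1), ?_⟩
    simpa using integral_mono_ae (hint e 0) (integrable_const 1) ((hb e 0).mono fun ω h => h.2)
  -- The regret has the same expectation as the sum of the gaps for the mean weights, which is
  -- bounded along each run by the radii and the indicators of the failures.
  have hgap := integral_gap M hM r hw_meas hw_indep hint hm xstar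
  refine ⟨integrable_finsetSum _ fun t _ => (hgap t).1, ?_⟩
  set F : ℕ → Set Ω := fun t => {ω | EstimateFails M r (fun i => w i ω) m t} with hF
  have hFmeas : ∀ t, MeasurableSet (F t) := by
    intro t
    have : F t = ⋃ e, {ω | radius t ((opmState M r (fun i => w i ω) t).T e) <
        |(opmState M r (fun i => w i ω) t).est e - m e|} := by
      ext ω; simp [hF, EstimateFails]
    rw [this]
    refine MeasurableSet.iUnion fun e => ?_
    obtain ⟨h1, h2⟩ := measurable_opmState M r w t (fun i _ => hw_meas i) e
    exact measurableSet_lt ((measurable_radius t).comp h1) (h2.sub_const _).abs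
  have hFint : ∀ t, Integrable ((F t).indicator (1 : Ω → ℝ)) μ := fun t =>
    (integrable_const 1).indicator (hFmeas t)
  set C := 8 * Real.sqrt (M.rank * L * n * Real.log n)
  have hpt : ∀ ω, ∑ t ∈ Finset.range n, (m ⬝ᵥ xstar - m ⬝ᵥ opmBasis M r (fun i => w i ω) t) ≤
      C + M.rank * ∑ t ∈ Finset.range n, (F t).indicator (1 : Ω → ℝ) ω := by
    intro ω
    have h1 := Finset.sum_le_sum fun t (_ : t ∈ Finset.range n) =>
      gap_le M r (fun i => w i ω) hm01 hxstar.1 t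
    rw [Finset.sum_add_distrib, ← Finset.mul_sum, ← Finset.mul_sum] at h1
    have h2 := sum_radius_le M r (fun i => w i ω) hM n
    have h3 : ∀ t, (F t).indicator (1 : Ω → ℝ) ω =
        if EstimateFails M r (fun i => w i ω) m t then 1 else 0 := fun t => by
      simp [Set.indicator_apply, hF]
    simp_rw [h3]
    linarith
  calc ∫ ω, regret M r xstar (fun t => w t ω) n ∂μ
      = ∫ ω, ∑ t ∈ Finset.range n,
          (m ⬝ᵥ xstar - m ⬝ᵥ opmBasis M r (fun i => w i ω) t) ∂μ := by
        unfold regret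
        rw [integral_finsetSum _ fun t _ => (hgap t).1,
          integral_finsetSum _ fun t _ => (hgap t).2.1]
        exact Finset.sum_congr rfl fun t _ => (hgap t).2.2
    _ ≤ ∫ ω, (C + M.rank * ∑ t ∈ Finset.range n, (F t).indicator (1 : Ω → ℝ) ω) ∂μ :=
        integral_mono (integrable_finsetSum _ fun t _ => (hgap t).2.1)
          ((integrable_const C).add ((integrable_finsetSum _ fun t _ => hFint t).const_mul _)) hpt
    _ = C + M.rank * ∑ t ∈ Finset.range n, μ.real (F t) := by
        rw [integral_add (integrable_const C)
          ((integrable_finsetSum _ fun t _ => hFint t).const_mul _),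
          integral_const_mul M.rank, integral_finsetSum _ fun t _ => hFint t, integral_const,
          probReal_univ, one_smul]
        simp_rw [integral_indicator_one (hFmeas _)]
    _ ≤ C + 4 / 3 * Real.pi ^ 2 * (L : ℝ) ^ 2 := by
        exact add_le_add le_rfl (rank_mul_sum_le M hM r _ measureReal_le_one
          (fun t ht => measure_estimateFails_le M r m hw_meas hw_indep hb hm ht) n)
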